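/- Let $C=\{(x,y,z)\in\mathbb{R}^3 : x\le -\sqrt{y^2+z^2}\}$, let $C^\circ=\{y\in\mathbb{R}^3:\langle x,y\rangle\le 0 \text{ for all } x\in C\}$, and let $\Omega=\operatorname{int}C^\circ\cap S^2$. For $\alpha>0$ put $\omega_\alpha=\{v\in\Omega : \delta_{\partial\Omega}(v)>\alpha\}$, where $\partial\Omega$ is the boundary of $\Omega$ in $S^2$ and $\delta_{\partial\Omega}$ is the spherical distance to it. For $m>0$ and a Borel measure $\mu$ on $\Omega$ let $$J_m(\mu)=\int_0^{\pi/2}\mu(\omega_\alpha)^{1/m}\,d\alpha\in[0,\infty].$$ A nonempty closed convex set $K\subset\mathbb{R}^3$ is called $C$-asymptotic if $\lambda x\in K$ for all $x\in K$ and $\lambda\ge 1$, if its recession cone $\{y : x+\lambda y\in K \text{ for all } x\in K,\ \lambda\ge 1\}$ equals $C$, and if $\operatorname{dist}(x,\partial C)\to 0$ as $|x|\to\infty$ with $x\in\partial K$. Its surface area measure is $S_K(\eta)=\mathcal{H}^2(\{x\in\partial K : \langle x,v\rangle=h_K(v)\text{ for some }v\in\eta\})$ for Borel sets $\eta\subset\Omega$,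 where $h_K(v)=\sup_{x\in K}\langle x,v\rangle$. Let $0<m<2$. Then there exists a $C$-asymptotic set $K$ with $J_m(S_K)=\infty$. Hence, although $J_m(\mu)<\infty$ implies $J_2(\mu)<\infty$ for every Borel measure $\mu$ on $\Omega$ (so that $J_m<\infty$ is a stronger condition than $J_2<\infty$), it is not true that $J_m(S_K)<\infty$ for every $C$-asymptotic set $K$. -/

import Mathlib

open scoped ENNReal Topology

namespace PseudoCone

noncomputable section

/-- Three-dimensional Euclidean space `ℝ³`. -/
abbrev E3 : Type := EuclideanSpace ℝ (Fin 3)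

/-- The polar (dual) cone `C° = {y : ⟨x, y⟩ ≤ 0 for all x ∈ C}`. -/
def polarCone (C : Set E3) : Set E3 :=
  {y | ∀ x ∈ C, inner ℝ x y ≤ 0}

/-- `Ω = int C° ∩ S²`, an open subset of the unit sphere. -/
def Omega (C : Set E3) : Set E3 :=
  interior (polarCone C) ∩ Metric.sphere 0 1

/-- `∂Ω`, the boundary of `Ω` relative to the unit sphere `S²`: the points that are both in the
closure of `Ω` and in the closure of `S² \ Ω`. -/
def bdryOmega (C : Set E3) : Set E3 :=
  closure (Omega C) ∩ closure (Metric.sphere 0 1 \ Omega C)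

/-- `δ_{∂Ω}(v)`, the spherical (geodesic) distance from a unit vector `v` to `∂Ω`: the spherical
distance of two unit vectors is the angle between them. -/
def sphDist (C : Set E3) (v : E3) : ℝ :=
  sInf ((fun w => InnerProductGeometry.angle v w) '' bdryOmega C)

/-- `ω_α = {v ∈ Ω : δ_{∂Ω}(v) > α}`. -/
def omega (C : Set E3) (α : ℝ) : Set E3 :=
  {v | v ∈ Omega C ∧ α < sphDist C v}

/-- A pseudo cone: a nonempty closed convex set `K` with `λ x ∈ K` for all `x ∈ K`, `λ ≥ 1`. -/
structure IsPseudoCone (K : Set E3) : Prop where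
  nonempty : K.Nonempty
  isClosed : IsClosed K
  convex : Convex ℝ K
  smul_mem : ∀ x ∈ K, ∀ l : ℝ, 1 ≤ l → l • x ∈ K

/-- The recession cone `rec K = {y : x + λ y ∈ K for all x ∈ K, λ ≥ 1}`. -/
def recCone (K : Set E3) : Set E3 :=
  {y | ∀ x ∈ K, ∀ l : ℝ, 1 ≤ l → x + l • y ∈ K}

/-- `K` is a `C`-pseudo set: a pseudo cone whose recession cone is `C`. -/
def IsCPseudo (C K : Set E3) : Prop :=
  IsPseudoCone K ∧ recCone K = C

/-- `K` is a `C`-asymptotic set: a `C`-pseudo set such that `dist(x, ∂C) → 0` for `x ∈ ∂K`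
as `|x| → ∞`. -/
def IsCAsymptotic (C K : Set E3) : Prop :=
  IsCPseudo C K ∧
    ∀ ε : ℝ, 0 < ε → ∃ R : ℝ, ∀ x ∈ frontier K, R < ‖x‖ → Metric.infDist x (frontier C) < ε

/-- The support function `h_K(y) = sup_{x ∈ K} ⟨x, y⟩`. For a `C`-pseudo set `K` and `y ∈ C°` the
supremum is over a nonempty set that is bounded above by `0`, because `K ⊆ C`. -/
def supportFn (K : Set E3) (y : E3) : ℝ :=
  sSup ((fun x => inner ℝ x y) '' K)

/-- The inverse Gauss image `τ_K(η) = {x ∈ ∂K : ⟨x, v⟩ = h_K(v) for some v ∈ η}`. -/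
def invGauss (K : Set E3) (η : Set E3) : Set E3 :=
  {x | x ∈ frontier K ∧ ∃ v ∈ η, inner ℝ x v = supportFn K v}

/-- The surface area measure `S_K(η) = ℋ²(τ_K(η))` of a `C`-pseudo set `K`, for Borel sets
`η ⊆ Ω`, recorded through its values. Here `μHE[2]` is the two-dimensional Hausdorff
measure, normalized so that it is the usual area on planes. -/
def surfaceArea (K : Set E3) (η : Set E3) : ℝ≥0∞ :=
  (MeasureTheory.Measure.euclideanHausdorffMeasure 2 : MeasureTheory.Measure E3) (invGauss K η)

/-- `J_m(μ) = ∫₀^{π/2} μ(ω_α)^{1/m} dα ∈ [0, ∞]` for `m > 0`; only the values of `μ` on subsets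
of `Ω` matter. -/
def J (C : Set E3) (m : ℝ) (μ : Set E3 → ℝ≥0∞) : ℝ≥0∞ :=
  ∫⁻ α in Set.Ioo (0 : ℝ) (Real.pi / 2), μ (omega C α) ^ (1 / m)

/-- The circular cone `{(x, y, z) : x ≤ -√(y² + z²)}`. -/
def circularCone : Set E3 :=
  {p | p 0 ≤ -Real.sqrt (p 1 ^ 2 + p 2 ^ 2)}

end

end PseudoCone

namespace PseudoCone

noncomputable section

/-! Put `q = 2 / m`; then `m < 2` says `q > 1`. Take for `K` the region below the graph of `w ↦
-f(|w|)`, where `f(r) = r + (1 + r)^(1 - q) / (q - 1)`. The profile `f` is convex, and its gap above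
the asymptote `r` tends to `0` because `q > 1`, so `K` is `C`-asymptotic (`isCAsymptotic_body`).

An outer normal over radius `r` is `(1, k)` with `|k| = f'(r) = 1 - (1 + r)^(-q)`. Its direction has
distance at least `(1 - |k|) / 2` from `∂Ω` (`le_sphDist`, `normalize_mem_omega`). Hence the part of
`∂K` over the disc of radius `R`, where `(1 + R)^(-q) = 2α`, has normals in `ω_α`. Projection does
not increase area, so `S_K(ω_α) ≥ R²`, which is of order `α^(-2/q) = α^(-m)` for small `α`. Its
power `1/m` dominates a multiple of `1/α`, which is not integrable at `0`. -/

/-- The Euclidean plane. -/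
abbrev E2 : Type := EuclideanSpace ℝ (Fin 2)

/-- The orthogonal projection `(x, y, z) ↦ (y, z)`. -/
def tail : E3 →L[ℝ] E2 :=
  LinearMap.toContinuousLinearMap
    { toFun := fun x => !₂[x 1, x 2]
      map_add' := fun x y => by ext i; fin_cases i <;> simp
      map_smul' := fun c x => by ext i; fin_cases i <;> simp }

/-- The point `(a, w)` of `ℝ × ℝ² = ℝ³`. -/
def cons (a : ℝ) (w : E2) : E3 := !₂[a, w 0, w 1]

theorem tail_apply (x : E3) : tail x = !₂[x 1, x 2] := rfl

@[simp] theorem cons_zero (a : ℝ) (w : E2) : cons a w 0 = a := rfl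

@[simp] theorem tail_cons (a : ℝ) (w : E2) : tail (cons a w) = w := by
  ext i; fin_cases i <;> rfl

theorem inner_eq (x y : E3) :
    inner ℝ x y = x 0 * y 0 + inner ℝ (tail x) (tail y) := by
  simp only [PiLp.inner_apply, Fin.sum_univ_three, Fin.sum_univ_two, tail_apply]
  simp
  ring

theorem norm_sq_eq (x : E3) : ‖x‖ ^ 2 = x 0 ^ 2 + ‖tail x‖ ^ 2 := by
  rw [← real_inner_self_eq_norm_sq, ← real_inner_self_eq_norm_sq, inner_eq]; ring

theorem norm_tail_le (x : E3) : ‖tail x‖ ≤ ‖x‖ :=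
  abs_le_of_sq_le_sq' (by nlinarith [norm_sq_eq x, sq_nonneg (x 0)]) (norm_nonneg _) |>.2

theorem mem_circularCone (x : E3) : x ∈ circularCone ↔ x 0 ≤ -‖tail x‖ := by
  have : ‖tail x‖ = Real.sqrt (x 1 ^ 2 + x 2 ^ 2) := by
    rw [EuclideanSpace.norm_eq, Fin.sum_univ_two]; simp [tail_apply]
  rw [this]; rfl

theorem continuous_coord_zero : Continuous fun x : E3 => x 0 := by fun_prop

theorem isClosed_circularCone : IsClosed circularCone := by
  have : circularCone = {x : E3 | x 0 ≤ -‖tail x‖} := Set.ext mem_circularCone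
  rw [this]
  exact isClosed_le continuous_coord_zero (by fun_prop)

/-- A point above whose height a set contains nothing lies outside the interior. -/
theorem notMem_interior_of_forall_pos {S : Set E3} {x : E3}
    (h : ∀ t : ℝ, 0 < t → x + cons t 0 ∉ S) : x ∉ interior S := by
  intro hx
  have hc : Filter.Tendsto (fun t : ℝ => x + t • cons 1 0) (𝓝[>] 0) (𝓝 x) := by
    have : Continuous fun t : ℝ => x + t • cons 1 0 := by fun_prop
    have h0 := this.tendsto 0
    simp only [zero_smul, add_zero] at h0
    exact h0.mono_left nhdsWithin_le_nhds
  have h1 := hc.eventually (mem_interior_iff_mem_nhds.1 hx)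
  obtain ⟨t, ht, ht0⟩ := (h1.and self_mem_nhdsWithin).exists
  apply h t ht0
  have : cons t 0 = t • cons 1 0 := by
    ext i; fin_cases i <;> simp [cons]
  rwa [this]

theorem mem_frontier_circularCone {x : E3} (hx : x 0 = -‖tail x‖) :
    x ∈ frontier circularCone := by
  rw [isClosed_circularCone.frontier_eq]
  refine ⟨(mem_circularCone x).2 hx.le, notMem_interior_of_forall_pos fun t ht hm => ?_⟩
  rw [mem_circularCone] at hm
  simp at hm
  linarith

/-! ### The polar cone and the spherical distance to its boundary -/

theorem mem_polarCone_circularCone (v : E3) :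
    v ∈ polarCone circularCone ↔ ‖tail v‖ ≤ v 0 := by
  constructor
  · intro h
    have h1 := h (cons (-‖tail v‖) (tail v)) ((mem_circularCone _).2 (by simp))
    have h2 := h (cons (-1) 0) ((mem_circularCone _).2 (by simp))
    rw [inner_eq] at h1 h2
    simp at h1 h2
    by_contra! hlt
    have : 0 < ‖tail v‖ := by linarith
    nlinarith
  · intro h x hx
    rw [mem_circularCone] at hx
    rw [inner_eq]
    have := real_inner_le_norm (tail x) (tail v)
    nlinarith [norm_nonneg (tail x), norm_nonneg (tail v)]

theorem mem_interior_polarCone {v : E3} (h : ‖tail v‖ < v 0) :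
    v ∈ interior (polarCone circularCone) := by
  refine interior_maximal (t := {v : E3 | ‖tail v‖ < v 0}) ?_ ?_ h
  · exact fun w hw => (mem_polarCone_circularCone w).2 hw.le
  · exact isOpen_lt (by fun_prop) continuous_coord_zero

/-- The real infimum defining `sphDist` can be bounded below through its members only if there are
some. The meridian `u θ` crosses `∂Ω` at `θ = π/4`. -/
theorem bdryOmega_circularCone_nonempty : (bdryOmega circularCone).Nonempty := by
  set u : ℝ → E3 := fun θ => cons (Real.cos θ) (!₂[Real.sin θ, 0]) with hu
  have htail : ∀ θ, ‖tail (u θ)‖ = |Real.sin θ| := fun θ => by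
    rw [hu]; simp only [tail_cons]
    rw [EuclideanSpace.norm_eq, Fin.sum_univ_two]; simp [Real.sqrt_sq_eq_abs]
  have hu1 : ∀ θ, u θ ∈ Metric.sphere (0 : E3) 1 := fun θ => by
    have := norm_sq_eq (u θ)
    rw [htail, sq_abs] at this
    simp only [hu, cons_zero, Real.cos_sq_add_sin_sq] at this
    rw [mem_sphere_zero_iff_norm]
    nlinarith [norm_nonneg (u θ)]
  have hcont : Continuous u := by
    refine (PiLp.continuous_toLp 2 _).comp (continuous_pi fun i => ?_)
    fin_cases i
    · exact Real.continuous_cos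
    · exact Real.continuous_sin
    · exact continuous_const
  refine ⟨u (Real.pi / 4), ?_, ?_⟩
  · have hlim : Filter.Tendsto u (𝓝[<] (Real.pi / 4)) (𝓝 (u (Real.pi / 4))) :=
      (hcont.tendsto _).mono_left nhdsWithin_le_nhds
    refine mem_closure_of_tendsto hlim ?_
    filter_upwards [Ioo_mem_nhdsLT (show (0 : ℝ) < Real.pi / 4 by positivity)] with θ hθ
    refine ⟨mem_interior_polarCone ?_, hu1 θ⟩
    have hpi := Real.pi_pos
    have h1 : 0 < Real.sin θ := Real.sin_pos_of_pos_of_lt_pi hθ.1 (by linarith [hθ.2])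
    have h2 : Real.sin θ < Real.sin (Real.pi / 4) :=
      Real.sin_lt_sin_of_lt_of_le_pi_div_two (by linarith [hθ.1]) (by linarith) hθ.2
    have h3 : Real.cos (Real.pi / 4) < Real.cos θ :=
      Real.cos_lt_cos_of_nonneg_of_le_pi_div_two hθ.1.le (by linarith) hθ.2
    rw [htail, abs_of_pos h1]
    simp only [hu, cons_zero]
    rw [Real.sin_pi_div_four] at h2
    rw [Real.cos_pi_div_four] at h3
    linarith
  · refine subset_closure ⟨hu1 _, fun hm => ?_⟩
    -- The polar cone is left by moving down the axis, whereas the criterion moves up; hence the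
    -- reflection.
    refine notMem_interior_of_forall_pos (S := (fun x => -x) ⁻¹' polarCone circularCone)
      (x := -u (Real.pi / 4)) (fun t ht hm' => ?_) ?_
    · rw [Set.mem_preimage, mem_polarCone_circularCone] at hm'
      simp only [neg_add_rev, map_add, map_neg, tail_cons, neg_zero, neg_neg, zero_add,
        htail, PiLp.add_apply, PiLp.neg_apply, cons_zero] at hm'
      rw [abs_of_pos (by rw [Real.sin_pi_div_four]; positivity), Real.sin_pi_div_four] at hm'
      simp only [hu, cons_zero, Real.cos_pi_div_four] at hm'
      linarith
    · have : interior ((fun x : E3 => -x) ⁻¹' polarCone circularCone) =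
          (fun x : E3 => -x) ⁻¹' interior (polarCone circularCone) :=
        ((Homeomorph.neg E3).preimage_interior _).symm
      rw [this, Set.mem_preimage, neg_neg]
      exact hm.1

theorem le_norm_tail_of_mem_bdryOmega {w : E3} (hw : w ∈ bdryOmega circularCone) :
    w 0 ≤ ‖tail w‖ := by
  have hsub : Metric.sphere (0 : E3) 1 \ Omega circularCone ⊆ {w : E3 | w 0 ≤ ‖tail w‖} := by
    intro w hw
    by_contra h
    exact hw.2 ⟨mem_interior_polarCone (not_le.1 h), hw.1⟩
  exact closure_minimal hsub (isClosed_le continuous_coord_zero (by fun_prop)) hw.2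

theorem norm_eq_one_of_mem_bdryOmega {C : Set E3} {w : E3} (hw : w ∈ bdryOmega C) : ‖w‖ = 1 := by
  have := closure_minimal (Set.sdiff_subset (s := Metric.sphere (0 : E3) 1) (t := Omega C))
    Metric.isClosed_sphere hw.2
  simpa using this

/-- The chord is at most the arc. -/
theorem norm_sub_le_angle {v w : E3} (hv : ‖v‖ = 1) (hw : ‖w‖ = 1) :
    ‖v - w‖ ≤ InnerProductGeometry.angle v w := by
  have h := Real.one_sub_sq_div_two_le_cos (x := InnerProductGeometry.angle v w)
  have h1 := norm_sub_sq_real v w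
  have h2 := InnerProductGeometry.cos_angle_mul_norm_mul_norm v w
  rw [hv, hw] at h1 h2
  refine abs_le_of_sq_le_sq' ?_ (InnerProductGeometry.angle_nonneg v w) |>.2
  linarith

/-- The function `v 0 - ‖tail v‖` is `√2`-Lipschitz and nonpositive on `∂Ω`, and the chord bounds
the arc from below. -/
theorem le_sphDist {v : E3} (hv : ‖v‖ = 1) :
    (v 0 - ‖tail v‖) / Real.sqrt 2 ≤ sphDist circularCone v := by
  refine le_csInf (bdryOmega_circularCone_nonempty.image _) ?_
  rintro _ ⟨w, hw, rfl⟩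
  refine le_trans ?_ (norm_sub_le_angle hv (norm_eq_one_of_mem_bdryOmega hw))
  have h1 := le_norm_tail_of_mem_bdryOmega hw
  have h2 := norm_sub_norm_le (tail w) (tail v)
  have h3 := norm_sq_eq (v - w)
  rw [map_sub, norm_sub_rev (tail v)] at h3
  have h4 : (v - w) 0 = v 0 - w 0 := rfl
  rw [h4] at h3
  have hs : (0 : ℝ) < Real.sqrt 2 := by positivity
  have hs2 : Real.sqrt 2 ^ 2 = 2 := Real.sq_sqrt (by norm_num)
  rw [div_le_iff₀ hs]
  have h5 : v 0 - ‖tail v‖ ≤ (v 0 - w 0) + ‖tail w - tail v‖ := by linarith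
  refine h5.trans (abs_le_of_sq_le_sq' ?_ (by positivity)).2
  rw [mul_pow, hs2, h3]
  nlinarith [sq_nonneg ((v 0 - w 0) - ‖tail w - tail v‖)]

/-- The normalization of `(1, k)` with `‖k‖ < 1 - 2 α` belongs to `ω_α`. -/
theorem normalize_mem_omega {k : E2} {α : ℝ} (hα : 0 ≤ α) (hk : 2 * α < 1 - ‖k‖) :
    ‖cons 1 k‖⁻¹ • cons 1 k ∈ omega circularCone α := by
  have hN := norm_sq_eq (cons 1 k)
  simp only [cons_zero, tail_cons] at hN
  set N := ‖cons 1 k‖ with hNdef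
  have hk0 := norm_nonneg k
  have hN0 : 0 < N := by
    have : 0 ≤ N := norm_nonneg _
    by_contra hle
    have : N = 0 := by linarith
    rw [this] at hN; nlinarith
  have hv : ‖N⁻¹ • cons 1 k‖ = 1 := by
    rw [norm_smul, norm_inv, Real.norm_of_nonneg hN0.le, ← hNdef, inv_mul_cancel₀ hN0.ne']
  have hv0 : (N⁻¹ • cons 1 k) 0 = N⁻¹ := by simp
  have hvt : ‖tail (N⁻¹ • cons 1 k)‖ = N⁻¹ * ‖k‖ := by
    rw [map_smul, tail_cons, norm_smul, Real.norm_of_nonneg (by positivity)]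
  refine ⟨⟨mem_interior_polarCone ?_, by simpa using hv⟩, lt_of_lt_of_le ?_ (le_sphDist hv)⟩
  · rw [hv0, hvt]
    have : 0 < N⁻¹ := by positivity
    nlinarith
  · have hs : (0 : ℝ) < Real.sqrt 2 := by positivity
    have hs2 : Real.sqrt 2 ^ 2 = 2 := Real.sq_sqrt (by norm_num)
    rw [hv0, hvt, lt_div_iff₀ hs, show N⁻¹ - N⁻¹ * ‖k‖ = (1 - ‖k‖) / N by ring, lt_div_iff₀ hN0]
    -- `N² = 1 + ‖k‖² ≤ 2`; this is the source of the factor in `2 * α`.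
    have hNle : Real.sqrt 2 * N ≤ 2 := by
      refine (abs_le_of_sq_le_sq' ?_ (by norm_num)).2
      rw [mul_pow, hs2, hN]; nlinarith
    nlinarith

/-! ### The convex profile -/

/-- The height of the profile curve above its asymptote. -/
def gap (q r : ℝ) : ℝ := (1 + r) ^ (1 - q) / (q - 1)

/-- The profile curve. -/
def profile (q r : ℝ) : ℝ := r + gap q r

/-- The derivative of the profile curve. -/
def slope (q r : ℝ) : ℝ := 1 - (1 + r) ^ (-q)

section Profile

variable {q r t : ℝ}

theorem gap_nonneg (hq : 1 < q) (hr : 0 ≤ r) : 0 ≤ gap q r :=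
  div_nonneg (Real.rpow_nonneg (by linarith) _) (by linarith)

theorem gap_anti (hq : 1 < q) (hr : 0 ≤ r) (h : r ≤ t) : gap q t ≤ gap q r :=
  div_le_div_of_nonneg_right
    (Real.rpow_le_rpow_of_nonpos (by linarith) (by linarith) (by linarith)) (by linarith)

theorem tendsto_gap (hq : 1 < q) : Filter.Tendsto (gap q) Filter.atTop (𝓝 0) := by
  have h := (tendsto_rpow_neg_atTop (show 0 < q - 1 by linarith)).comp
    (Filter.tendsto_atTop_add_const_left Filter.atTop 1 Filter.tendsto_id)
  have h2 := h.div_const (q - 1)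
  rw [zero_div] at h2
  refine h2.congr fun r => ?_
  simp [gap]

theorem slope_nonneg (hq : 1 < q) (hr : 0 ≤ r) : 0 ≤ slope q r := by
  have := Real.rpow_le_one_of_one_le_of_nonpos (x := 1 + r) (z := -q) (by linarith) (by linarith)
  unfold slope; linarith

theorem slope_zero : slope q 0 = 0 := by simp [slope]

/-- The profile lies above its tangents. -/
theorem profile_tangent (hq : 1 < q) (hr : 0 ≤ r) (ht : 0 ≤ t) :
    profile q r + slope q r * (t - r) ≤ profile q t := by
  have hu : 0 < 1 + r := by linarith
  have hw : 0 < 1 + t := by linarith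
  have hp : 0 < q - 1 := by linarith
  set x := (1 + t) / (1 + r) with hx
  have hx0 : 0 < x := by positivity
  -- Bernoulli's inequality for a negative exponent, from `exp s ≥ 1 + s` and `log x ≤ x - 1`.
  -- Scaling by `1 + r` turns it into the tangent inequality at `r`.
  have hbern : 1 - (q - 1) * (x - 1) ≤ x ^ (1 - q) := by
    rw [Real.rpow_def_of_pos hx0]
    have h1 := Real.add_one_le_exp (Real.log x * (1 - q))
    have h2 := Real.log_le_sub_one_of_pos hx0
    nlinarith
  have hU : 0 < (1 + r) ^ (1 - q) := Real.rpow_pos_of_pos hu _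
  have hgt : (1 + t) ^ (1 - q) = (1 + r) ^ (1 - q) * x ^ (1 - q) := by
    rw [← Real.mul_rpow hu.le hx0.le, hx, mul_div_cancel₀ _ hu.ne']
  have hs : (1 + r) ^ (-q) = (1 + r) ^ (1 - q) / (1 + r) := by
    rw [← Real.rpow_sub_one hu.ne']; congr 1; ring
  have hxr : (t - r) / (1 + r) = x - 1 := by rw [hx]; field_simp; ring
  have key : (1 + r) ^ (1 - q) * (1 - (q - 1) * (x - 1)) / (q - 1) ≤ gap q t := by
    unfold gap
    rw [hgt]
    exact div_le_div_of_nonneg_right (mul_le_mul_of_nonneg_left hbern hU.le) hp.le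
  have e : (1 + r) ^ (1 - q) * (1 - (q - 1) * (x - 1)) / (q - 1) =
      gap q r - (1 + r) ^ (-q) * (t - r) := by
    rw [hs, div_mul_eq_mul_div, mul_div_assoc _ (t - r), hxr]
    unfold gap
    field_simp
  rw [e] at key
  unfold profile slope
  linarith

theorem profile_mono (hq : 1 < q) (hr : 0 ≤ r) (h : r ≤ t) : profile q r ≤ profile q t := by
  have h1 := profile_tangent hq hr (hr.trans h)
  have h2 := mul_nonneg (slope_nonneg hq hr) (sub_nonneg.2 h)
  linarith

theorem profile_add_le (hq : 1 < q) (hr : 0 ≤ r) (ht : 0 ≤ t) :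
    profile q (r + t) ≤ profile q r + t := by
  have := gap_anti hq hr (show r ≤ r + t by linarith)
  unfold profile; linarith

theorem le_profile (hq : 1 < q) (hr : 0 ≤ r) : r ≤ profile q r := by
  have := gap_nonneg hq hr
  unfold profile; linarith

theorem continuous_profile_norm : Continuous fun w : E2 => profile q ‖w‖ := by
  unfold profile gap
  refine continuous_norm.add (Continuous.div_const ?_ _)
  exact (continuous_const.add continuous_norm).rpow_const
    fun w => Or.inl (add_pos_of_pos_of_nonneg one_pos (norm_nonneg w)).ne'

end Profile

/-! ### The rotationally symmetric asymptotic set -/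

/-- The region below the graph of `w ↦ -profile q |w|`. -/
def body (q : ℝ) : Set E3 := {x | x 0 ≤ -profile q ‖tail x‖}

section Body

variable {q : ℝ}

theorem cons_mem_body (w : E2) : cons (-profile q ‖w‖) w ∈ body q := by
  simp [body]

theorem isClosed_body : IsClosed (body q) :=
  isClosed_le continuous_coord_zero (continuous_profile_norm.comp tail.continuous).neg

theorem frontier_body_subset :
    frontier (body q) ⊆ {x | x 0 = -profile q ‖tail x‖} :=
  frontier_le_subset_eq continuous_coord_zero
    (continuous_profile_norm.comp tail.continuous).neg

theorem cons_mem_frontier_body (w : E2) :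
    cons (-profile q ‖w‖) w ∈ frontier (body q) := by
  rw [(isClosed_body).frontier_eq]
  refine ⟨cons_mem_body w, notMem_interior_of_forall_pos fun t ht hm => ?_⟩
  simp [body] at hm
  linarith

/-- The tangent to the profile at `‖tail z‖` bounds it below at both endpoints; since its slope is
nonnegative, the triangle inequality for `tail z` goes the right way. -/
theorem convex_body (hq : 1 < q) : Convex ℝ (body q) := by
  intro x hx y hy a b ha hb hab
  set z := a • x + b • y with hz
  have hz0 : z 0 = a * x 0 + b * y 0 := by simp [hz]
  have hzt : ‖tail z‖ ≤ a * ‖tail x‖ + b * ‖tail y‖ := by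
    rw [hz, map_add, map_smul, map_smul]
    refine (norm_add_le _ _).trans ?_
    rw [norm_smul, norm_smul, Real.norm_of_nonneg ha, Real.norm_of_nonneg hb]
  have hx' : x 0 ≤ -profile q ‖tail x‖ := hx
  have hy' : y 0 ≤ -profile q ‖tail y‖ := hy
  have h1 := profile_tangent hq (norm_nonneg (tail z)) (norm_nonneg (tail x))
  have h2 := profile_tangent hq (norm_nonneg (tail z)) (norm_nonneg (tail y))
  have hs := slope_nonneg hq (norm_nonneg (tail z))
  change z 0 ≤ -profile q ‖tail z‖
  rw [hz0]
  have h3 := mul_le_mul_of_nonneg_left (h1.trans (le_neg_of_le_neg hx')) ha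
  have h4 := mul_le_mul_of_nonneg_left (h2.trans (le_neg_of_le_neg hy')) hb
  have h5 := mul_nonneg hs (sub_nonneg.2 hzt)
  obtain rfl : b = 1 - a := by linarith
  nlinarith

theorem isPseudoCone_body (hq : 1 < q) : IsPseudoCone (body q) where
  nonempty := ⟨_, cons_mem_body 0⟩
  isClosed := isClosed_body
  convex := convex_body hq
  smul_mem x hx l hl := by
    have hx' : x 0 ≤ -profile q ‖tail x‖ := hx
    change (l • x) 0 ≤ -profile q ‖tail (l • x)‖
    rw [map_smul, norm_smul, Real.norm_of_nonneg (by linarith), PiLp.smul_apply, smul_eq_mul]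
    have h0 := norm_nonneg (tail x)
    have h1 := gap_anti hq h0 (show ‖tail x‖ ≤ l * ‖tail x‖ by nlinarith)
    have h2 := gap_nonneg hq h0
    unfold profile at *
    nlinarith

theorem recCone_body (hq : 1 < q) : recCone (body q) = circularCone := by
  ext y
  rw [mem_circularCone]
  constructor
  · intro h
    by_contra! hlt
    set d := y 0 + ‖tail y‖ with hd
    have hd0 : 0 < d := by linarith
    have hf : 0 ≤ profile q ‖(0 : E2)‖ := by
      simpa using le_profile hq le_rfl
    -- Starting from the apex, membership would force `l * d ≤ profile q 0`; this `l` violates that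
    -- and is at least `1`.
    set l := (profile q ‖(0 : E2)‖ + 1) / d + 1 with hl
    have hl1 : 1 ≤ l := by
      have : 0 ≤ (profile q ‖(0 : E2)‖ + 1) / d := by positivity
      linarith
    have h1 : (cons (-profile q ‖(0 : E2)‖) 0 + l • y) 0 ≤
      -profile q ‖tail (cons (-profile q ‖(0 : E2)‖) 0 + l • y)‖ := h _ (cons_mem_body 0) l hl1
    have h2 := le_profile hq (norm_nonneg (tail (cons (-profile q ‖(0 : E2)‖) 0 + l • y)))
    rw [map_add, map_smul, tail_cons, zero_add, norm_smul, Real.norm_of_nonneg (by linarith)]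
      at h1 h2
    rw [PiLp.add_apply, PiLp.smul_apply, cons_zero, smul_eq_mul] at h1
    have h3 : l * d = profile q ‖(0 : E2)‖ + 1 + d := by rw [hl]; field_simp
    rw [hd] at h3
    nlinarith
  · intro hy x hx l hl
    have hx' : x 0 ≤ -profile q ‖tail x‖ := hx
    change (x + l • y) 0 ≤ -profile q ‖tail (x + l • y)‖
    have h1 : ‖tail (x + l • y)‖ ≤ ‖tail x‖ + l * ‖tail y‖ := by
      rw [map_add, map_smul]
      refine (norm_add_le _ _).trans ?_
      rw [norm_smul, Real.norm_of_nonneg (by linarith)]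
    have h2 := profile_mono hq (norm_nonneg _) h1
    have h3 := profile_add_le hq (norm_nonneg (tail x))
      (mul_nonneg (by linarith : (0 : ℝ) ≤ l) (norm_nonneg (tail y)))
    rw [PiLp.add_apply, PiLp.smul_apply, smul_eq_mul]
    nlinarith

theorem isCAsymptotic_body (hq : 1 < q) : IsCAsymptotic circularCone (body q) := by
  refine ⟨⟨isPseudoCone_body hq, recCone_body hq⟩, fun ε hε => ?_⟩
  obtain ⟨A, hA⟩ := Filter.eventually_atTop.1 ((tendsto_gap hq).eventually (gt_mem_nhds hε))
  set c := gap q 0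
  -- On the boundary `‖x‖ ≤ 2 * ‖tail x‖ + c`, so this radius forces `‖tail x‖ ≥ A`. The point of
  -- `∂C` on the same vertical line is then at distance `gap q ‖tail x‖ < ε`.
  refine ⟨2 * |A| + c, fun x hx hxR => ?_⟩
  have hx0 : x 0 = -profile q ‖tail x‖ := frontier_body_subset hx
  have ht := norm_nonneg (tail x)
  have hgc : gap q ‖tail x‖ ≤ c := gap_anti hq le_rfl ht
  have hg := gap_nonneg hq ht
  have hnorm : ‖x‖ ≤ 2 * ‖tail x‖ + c := by
    refine (abs_le_of_sq_le_sq' ?_ (by linarith)).2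
    rw [norm_sq_eq, hx0]
    unfold profile
    nlinarith
  have hAt : A ≤ ‖tail x‖ := by linarith [le_abs_self A]
  refine lt_of_le_of_lt (Metric.infDist_le_dist_of_mem
    (mem_frontier_circularCone (x := cons (-‖tail x‖) (tail x)) (by simp))) ?_
  have hd := norm_sq_eq (x - cons (-‖tail x‖) (tail x))
  rw [map_sub, tail_cons, sub_self, norm_zero, PiLp.sub_apply, cons_zero, hx0] at hd
  rw [dist_eq_norm]
  refine lt_of_le_of_lt (abs_le_of_sq_le_sq' ?_ hg).2 (hA _ hAt)
  rw [hd]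
  unfold profile
  nlinarith

/-- Cauchy–Schwarz reduces the supporting-plane property of `(1, k)` to the tangent inequality in
the radial variable. -/
theorem inner_le_of_mem_body (hq : 1 < q) {x : E3} (hx : x ∈ body q) {w k : E2}
    (hk : ‖k‖ = slope q ‖w‖) (hwk : inner ℝ w k = ‖w‖ * ‖k‖) :
    inner ℝ x (cons 1 k) ≤ inner ℝ (cons (-profile q ‖w‖) w) (cons 1 k) := by
  have hx' : x 0 ≤ -profile q ‖tail x‖ := hx
  rw [inner_eq, inner_eq]
  simp only [tail_cons, cons_zero, mul_one]
  have h1 := real_inner_le_norm (tail x) k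
  have h2 := profile_tangent hq (norm_nonneg w) (norm_nonneg (tail x))
  rw [hwk, hk]
  rw [hk] at h1
  nlinarith

/-- The points of `∂K` over a disc have their normals in `ω_α`. -/
theorem cons_mem_invGauss_body (hq : 1 < q) {α : ℝ} (hα : 0 ≤ α) {w : E2}
    (hw : 2 * α < (1 + ‖w‖) ^ (-q)) :
    cons (-profile q ‖w‖) w ∈ invGauss (body q) (omega circularCone α) := by
  refine ⟨cons_mem_frontier_body w, ?_⟩
  have hw0 := norm_nonneg w
  obtain ⟨k, hk, hwk⟩ : ∃ k : E2, ‖k‖ = slope q ‖w‖ ∧ inner ℝ w k = ‖w‖ * ‖k‖ := by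
    have hs := slope_nonneg hq hw0
    rcases eq_or_ne w 0 with rfl | hne
    · exact ⟨0, by simp [slope_zero], by simp⟩
    · have hpos : 0 < ‖w‖ := norm_pos_iff.2 hne
      have hn : ‖(slope q ‖w‖ / ‖w‖) • w‖ = slope q ‖w‖ := by
        rw [norm_smul, Real.norm_of_nonneg (by positivity), div_mul_cancel₀ _ hpos.ne']
      refine ⟨(slope q ‖w‖ / ‖w‖) • w, hn, ?_⟩
      rw [hn, real_inner_smul_right, real_inner_self_eq_norm_sq]
      field_simp
  refine ⟨‖cons 1 k‖⁻¹ • cons 1 k, normalize_mem_omega hα (by rw [hk]; unfold slope; linarith), ?_⟩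
  symm
  refine IsGreatest.csSup_eq ⟨⟨_, cons_mem_body w, rfl⟩, ?_⟩
  rintro _ ⟨x, hx, rfl⟩
  simp only [real_inner_smul_right]
  exact mul_le_mul_of_nonneg_left (inner_le_of_mem_body hq hx hk hwk) (by positivity)

end Body

/-! ### Areas and the integral `J` -/

/-- Projecting to the plane does not increase the area. -/
theorem volume_tail_image_le (s : Set E3) :
    MeasureTheory.volume (tail '' s) ≤
      (MeasureTheory.Measure.euclideanHausdorffMeasure 2 : MeasureTheory.Measure E3) s := by
  -- Both measures are the same multiple of the Hausdorff measure, which a `1`-Lipschitz map does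
  -- not increase.
  rw [← EuclideanSpace.euclideanHausdorffMeasure_eq_volume 2,
    MeasureTheory.Measure.euclideanHausdorffMeasure_def,
    MeasureTheory.Measure.euclideanHausdorffMeasure_def,
    MeasureTheory.Measure.smul_apply, MeasureTheory.Measure.smul_apply]
  have hl : LipschitzWith 1 tail := LipschitzWith.of_dist_le_mul fun x y => by
    rw [dist_eq_norm, dist_eq_norm, ← map_sub, NNReal.coe_one, one_mul]
    exact norm_tail_le _
  have := hl.hausdorffMeasure_image_le (d := ((2 : ℕ) : ℝ)) (by positivity) s
  rw [ENNReal.coe_one, ENNReal.one_rpow, one_mul] at this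
  exact smul_le_smul_of_nonneg_left this zero_le

theorem le_surfaceArea_body {q α R : ℝ} (hq : 1 < q) (hα : 0 < α) (hR : 0 ≤ R)
    (hRα : (1 + R) ^ (-q) = 2 * α) :
    ENNReal.ofReal (R ^ 2) ≤ surfaceArea (body q) (omega circularCone α) := by
  have hsub : Metric.ball (0 : E2) R ⊆ tail '' invGauss (body q) (omega circularCone α) := by
    intro w hw
    rw [mem_ball_zero_iff] at hw
    refine ⟨_, cons_mem_invGauss_body hq hα.le (w := w) ?_, tail_cons _ _⟩
    rw [← hRα]
    have := norm_nonneg w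
    exact Real.rpow_lt_rpow_of_neg (by linarith) (by linarith) (by linarith)
  refine le_trans ?_ ((MeasureTheory.measure_mono hsub).trans (volume_tail_image_le _))
  rw [EuclideanSpace.volume_ball_fin_two, ENNReal.ofReal_pow hR]
  have : 1 ≤ ENNReal.ofReal Real.pi := by
    rw [ENNReal.one_le_ofReal]; linarith [Real.pi_gt_three]
  simpa using mul_le_mul_right this (ENNReal.ofReal R ^ 2)

theorem lintegral_Ioo_const_mul_inv {a c : ℝ} (ha : 0 < a) (hc : 0 < c) :
    ∫⁻ x in Set.Ioo 0 a, ENNReal.ofReal (c * x⁻¹) = ⊤ := by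
  by_contra h
  rw [← ne_eq, MeasureTheory.lintegral_ofReal_ne_top_iff_integrable] at h
  · have h1 : MeasureTheory.IntegrableOn (fun x : ℝ => x ^ (-1 : ℝ)) (Set.Ioo 0 a) := by
      refine (h.const_mul c⁻¹).congr (Filter.Eventually.of_forall fun x => ?_)
      simp only
      rw [inv_mul_cancel_left₀ hc.ne', Real.rpow_neg_one]
    rw [intervalIntegral.integrableOn_Ioo_rpow_iff ha] at h1
    exact lt_irrefl _ h1
  · exact (measurable_inv.const_mul c).aestronglyMeasurable
  · filter_upwards [MeasureTheory.ae_restrict_mem measurableSet_Ioo] with x hx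
    have := hx.1
    simp only [Pi.zero_apply]
    positivity

theorem le_surfaceArea_body_rpow {m α : ℝ} (hm0 : 0 < m) (hm2 : m < 2) (hα : 0 < α)
    (hα1 : 2 * α < 2 ^ (-(2 / m))) :
    ENNReal.ofReal ((1 / 2) ^ (2 / m) / 2 * α⁻¹) ≤
      surfaceArea (body (2 / m)) (omega circularCone α) ^ (1 / m) := by
  set q := 2 / m with hqdef
  have hq : 1 < q := by rw [hqdef, lt_div_iff₀ hm0]; linarith
  have hq0 : 0 < q := by linarith
  set X := (2 * α) ^ (-q⁻¹) with hX
  have h2α : 0 < 2 * α := by linarith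
  have hXq : X ^ (-q) = 2 * α := by
    rw [hX, ← Real.rpow_mul h2α.le, neg_mul_neg, inv_mul_cancel₀ hq0.ne', Real.rpow_one]
  have hX0 : 0 < X := Real.rpow_pos_of_pos h2α _
  -- The smallness of `α` serves only here: it gives `X - 1 ≥ X / 2`, so that `(X - 1) ^ q` is at
  -- least a multiple of `X ^ q = (2 * α)⁻¹`.
  have hX2 : 2 ≤ X := by
    by_contra! hlt
    have := Real.rpow_lt_rpow_of_neg hX0 hlt (show -q < 0 by linarith)
    linarith
  have h1 := le_surfaceArea_body (R := X - 1) hq hα (by linarith) (by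
    rw [add_sub_cancel]; exact hXq)
  refine le_trans ?_ (ENNReal.rpow_le_rpow h1 (by positivity))
  rw [ENNReal.ofReal_rpow_of_nonneg (by positivity) (by positivity)]
  refine ENNReal.ofReal_le_ofReal ?_
  rw [← Real.rpow_natCast, ← Real.rpow_mul (by linarith), Nat.cast_ofNat, mul_one_div, ← hqdef]
  have h3 : X ^ q = (2 * α)⁻¹ := by rw [← hXq, Real.rpow_neg hX0.le, inv_inv]
  have h4 : (1 / 2 * X) ^ q ≤ (X - 1) ^ q :=
    Real.rpow_le_rpow (by positivity) (by linarith) hq0.le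
  rw [Real.mul_rpow (by norm_num) hX0.le, h3] at h4
  refine le_trans (le_of_eq ?_) h4
  rw [mul_inv]; ring

theorem J_surfaceArea_body {m : ℝ} (hm0 : 0 < m) (hm2 : m < 2) :
    J circularCone m (surfaceArea (body (2 / m))) = ⊤ := by
  set a : ℝ := 2 ^ (-(2 / m)) / 2 with ha
  have ha0 : 0 < a := by positivity
  have ha1 : a ≤ Real.pi / 2 := by
    have : (2 : ℝ) ^ (-(2 / m)) ≤ 1 :=
      Real.rpow_le_one_of_one_le_of_nonpos (by norm_num) (by
        have : 0 < 2 / m := by positivity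
        linarith)
    linarith [Real.pi_gt_three]
  rw [← top_le_iff, ← lintegral_Ioo_const_mul_inv (c := (1 / 2) ^ (2 / m) / 2) ha0 (by positivity)]
  refine le_trans ?_ (MeasureTheory.lintegral_mono_set (Set.Ioo_subset_Ioo_right ha1))
  refine MeasureTheory.setLIntegral_mono' measurableSet_Ioo fun α hα => ?_
  exact le_surfaceArea_body_rpow hm0 hm2 hα.1 (by have := hα.2; linarith)

/-- Pointwise `t^(1/n) ≤ 1 + t^(1/m)`, and the interval of integration has finite length. -/
theorem J_lt_top_of_le {C : Set E3} {m n : ℝ} (hm : 0 < m) (hmn : m ≤ n)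
    {μ : Set E3 → ℝ≥0∞} (h : J C m μ < ⊤) : J C n μ < ⊤ := by
  have hle : J C n μ ≤ ∫⁻ α in Set.Ioo (0 : ℝ) (Real.pi / 2), (1 + μ (omega C α) ^ (1 / m)) := by
    refine MeasureTheory.lintegral_mono fun α => ?_
    simp only
    rcases le_total (μ (omega C α)) 1 with h1 | h1
    · refine le_add_right ((ENNReal.rpow_le_rpow h1 ?_).trans (ENNReal.one_rpow _).le)
      have := hm.trans_le hmn
      positivity
    · exact le_add_left (ENNReal.rpow_le_rpow_of_exponent_le h1 (one_div_le_one_div_of_le hm hmn))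
  refine hle.trans_lt ?_
  rw [MeasureTheory.lintegral_add_left measurable_const]
  refine ENNReal.add_lt_top.2 ⟨?_, h⟩
  simp

end

end PseudoCone

theorem proposition4p6 (m : ℝ) (hm0 : 0 < m) (hm2 : m < 2) :
    (∃ K : Set PseudoCone.E3,
      PseudoCone.IsCAsymptotic PseudoCone.circularCone K ∧
      PseudoCone.J PseudoCone.circularCone m (PseudoCone.surfaceArea K) = ⊤) ∧
    (∀ μ : MeasureTheory.Measure PseudoCone.E3,
      PseudoCone.J PseudoCone.circularCone m (fun η => μ η) < ⊤ →
      PseudoCone.J PseudoCone.circularCone 2 (fun η => μ η) < ⊤) ∧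
    ¬ (∀ K : Set PseudoCone.E3,
      PseudoCone.IsCAsymptotic PseudoCone.circularCone K →
      PseudoCone.J PseudoCone.circularCone m (PseudoCone.surfaceArea K) < ⊤) := by
  have hq : 1 < 2 / m := by rw [lt_div_iff₀ hm0]; linarith
  have hK := PseudoCone.isCAsymptotic_body hq
  have hJ := PseudoCone.J_surfaceArea_body hm0 hm2
  exact ⟨⟨_, hK, hJ⟩, fun μ h => PseudoCone.J_lt_top_of_le hm0 hm2.le h,
    fun h => (h _ hK).ne hJ⟩
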